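/- Let $X$ be a complex-affine manifold, i.e. a smooth affine algebraic variety over $\mathbb{C}$ with coordinate ring $\mathbb{C}[X]$. The algebraic vector fields on $X$ are the $\mathbb{C}$-linear derivations of $\mathbb{C}[X]$. A derivation $\Theta$ of $\mathbb{C}[X]$ is locally nilpotent (an LND) if for every $f \in \mathbb{C}[X]$ there is $n \in \mathbb{N}$ with $\Theta^n(f) = 0$. An algebraic overshear vector field is a derivation of the form $f \cdot \Theta$, where $\Theta$ is an LND and $f \in \mathbb{C}[X]$ satisfies $\Theta^2(f) = 0$. We say that $X$ has the algebraic overshear density property if the Lie algebra over $\mathbb{C}$ generated by the algebraic overshear vector fields is the Lie algebra of all algebraic vector fields on $X$. If $X$ has the algebraic overshear density property, then $X$ is flexible: for every point $x \in X$, the tangent space $T_x X$ is the $\mathbb{C}$-linear span of the values $\Theta_x$ of the LNDs $\Theta$ on $X$. -/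

import Mathlib

/-!
A complex-affine manifold `X` is given by its coordinate ring `A = ℂ[X]`, a smooth (in particular
finitely generated and reduced) commutative `ℂ`-algebra. Its points are the maximal ideals of `A`,
its algebraic vector fields are the `ℂ`-linear derivations of `A`.
-/

namespace ComplexAffine

variable {A : Type*} [CommRing A] [Algebra ℂ A]

/-- A derivation `D` of `ℂ[X]` is locally nilpotent (an LND) if every regular function is
annihilated by some iterate of `D`. -/
def IsLND (D : Derivation ℂ A A) : Prop :=
  ∀ f : A, ∃ n : ℕ, (⇑D)^[n] f = 0

/-- An algebraic overshear vector field is a derivation of the form `f • Θ` with `Θ` an LND and `f`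
a regular function such that `Θ (Θ f) = 0`. -/
def IsAlgebraicOvershear (D : Derivation ℂ A A) : Prop :=
  ∃ (Θ : Derivation ℂ A A) (f : A), IsLND Θ ∧ Θ (Θ f) = 0 ∧ D = f • Θ

variable (A) in
/-- The algebraic overshear density property: the complex Lie algebra generated by the algebraic
overshear vector fields is the Lie algebra of all algebraic vector fields. -/
def AlgebraicOvershearDensityProperty : Prop :=
  LieSubalgebra.lieSpan ℂ (Derivation ℂ A A) {D | IsAlgebraicOvershear D} = ⊤

/-- The Zariski tangent space of `X` at the point `x`: the `ℂ`-linear derivations of `ℂ[X]` with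
values in the residue field `ℂ[X] ⧸ x` (which is `ℂ`, when `A` is of finite type over `ℂ`). -/
abbrev TangentSpaceAt (x : MaximalSpectrum A) : Type _ :=
  Derivation ℂ A (A ⧸ x.asIdeal)

/-- The value `D_x ∈ T_x X` of an algebraic vector field at the point `x`, that is, the derivation
`f ↦ (D f)(x)`. -/
def vectorAt (x : MaximalSpectrum A) (D : Derivation ℂ A A) : TangentSpaceAt x :=
  (Submodule.mkQ x.asIdeal).compDer D

variable (A) in
/-- `X` is flexible if at every point the values of the LNDs span the tangent space over `ℂ`. -/
def IsFlexible : Prop :=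
  ∀ x : MaximalSpectrum A, Submodule.span ℂ {v : TangentSpaceAt x | ∃ Θ, IsLND Θ ∧ v = vectorAt x Θ} = ⊤

end ComplexAffine

namespace ComplexAffine

open Finset

/-! ### Exponentials of locally nilpotent endomorphisms -/

section LocallyNilpotent

variable {V : Type*} [AddCommGroup V] [Module ℂ V]

/-! The `A`-module `M` spanned by the LNDs is closed under brackets. The Leibniz rule for `⁅D, g •
E⁆` reduces this to LNDs `Θ`, `Ψ`. Conjugating `Ψ` by `exp (tΘ)` gives the LND `exp (t ad Θ) Ψ`,
polynomial in `t` because `A` is finitely generated; its linear coefficient `⁅Θ, Ψ⁆` is therefore in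
the `ℂ`-span of LNDs. Since `M` contains the overshear fields, density makes it everything.
Smoothness lifts tangent vectors to vector fields, and at a point the coefficients in `A` become
complex numbers. -/

theorem pow_apply_eq_zero_of_le {T : Module.End ℂ V} {v : V} {m n : ℕ} (h : (T ^ m) v = 0)
    (hmn : m ≤ n) : (T ^ n) v = 0 := by
  obtain ⟨k, rfl⟩ := Nat.exists_eq_add_of_le' hmn
  rw [pow_add, Module.End.mul_apply, h, map_zero]

/-- The exponential series of `T`, truncated before degree `N`. -/
noncomputable def truncExp (T : Module.End ℂ V) (N : ℕ) : Module.End ℂ V :=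
  ∑ i ∈ range N, ((i.factorial : ℂ)⁻¹) • T ^ i

theorem truncExp_apply (T : Module.End ℂ V) (N : ℕ) (v : V) :
    truncExp T N v = ∑ i ∈ range N, ((i.factorial : ℂ)⁻¹) • (T ^ i) v := by
  simp [truncExp]

theorem truncExp_apply_eq {T : Module.End ℂ V} {v : V} {M N : ℕ} (hM : (T ^ M) v = 0)
    (hN : (T ^ N) v = 0) : truncExp T M v = truncExp T N v := by
  wlog h : M ≤ N generalizing M N
  · exact (this hN hM (le_of_not_ge h)).symm
  rw [truncExp_apply, truncExp_apply]
  refine sum_subset (range_subset_range.2 h) fun i _ hi => ?_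
  rw [pow_apply_eq_zero_of_le hM (by simpa using hi), smul_zero]

open Classical in
/-- The exponential of a locally nilpotent endomorphism. -/
noncomputable def locExp {T : Module.End ℂ V} (hT : ∀ v, ∃ n, (T ^ n) v = 0) (v : V) : V :=
  truncExp T (Nat.find (hT v)) v

theorem locExp_eq {T : Module.End ℂ V} (hT : ∀ v, ∃ n, (T ^ n) v = 0) {v : V} {N : ℕ}
    (hN : (T ^ N) v = 0) : locExp hT v = truncExp T N v := by
  classical
  exact truncExp_apply_eq (Nat.find_spec (hT v)) hN

theorem locExp_zero {T : Module.End ℂ V} (hT : ∀ v, ∃ n, (T ^ n) v = 0) :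
    locExp hT 0 = 0 := by
  rw [locExp_eq hT (N := 0) (by simp), map_zero]

theorem locExp_add {T : Module.End ℂ V} (hT : ∀ v, ∃ n, (T ^ n) v = 0) (v w : V) :
    locExp hT (v + w) = locExp hT v + locExp hT w := by
  obtain ⟨m, hm⟩ := hT v
  obtain ⟨n, hn⟩ := hT w
  have hv := pow_apply_eq_zero_of_le hm (le_max_left m n)
  have hw := pow_apply_eq_zero_of_le hn (le_max_right m n)
  rw [locExp_eq hT hv, locExp_eq hT hw, locExp_eq hT (N := max m n) (by rw [map_add, hv, hw, add_zero]),
    map_add]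

theorem commute_truncExp (T : Module.End ℂ V) (N : ℕ) : Commute T (truncExp T N) :=
  Commute.sum_right _ _ _ fun _ _ => ((Commute.refl T).pow_right _).smul_right _

/-- If `T ^ (n + 1)` kills `v`, then `T ^ n` kills `v - exp T v`; induct on `n`. -/
theorem locExp_surjective {T : Module.End ℂ V} (hT : ∀ v, ∃ n, (T ^ n) v = 0) :
    Function.Surjective (locExp hT) := by
  suffices H : ∀ n v, (T ^ n) v = 0 → ∃ w, locExp hT w = v from fun v =>
    (hT v).elim fun n hn => H n v hn
  intro n
  induction n with
  | zero =>
    intro v hv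
    exact ⟨0, by rw [locExp_zero]; simpa using hv.symm⟩
  | succ n ih =>
    intro v hv
    have key : (T ^ n) (v - locExp hT v) = 0 := by
      rw [locExp_eq hT hv, truncExp_apply, sum_range_succ']
      simp only [Nat.factorial_zero, Nat.cast_one, inv_one, pow_zero, Module.End.one_apply,
        one_smul, map_sub, map_add, map_sum, map_smul]
      rw [sum_eq_zero, zero_add, sub_self]
      intro i _
      rw [← Module.End.mul_apply, ← pow_add, pow_apply_eq_zero_of_le hv (by omega), smul_zero]
    obtain ⟨w, hw⟩ := ih _ key
    exact ⟨w + v, by rw [locExp_add, hw, sub_add_cancel]⟩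

/-- The linear map `S ↦ T * S - S * T`. -/
noncomputable def commutatorMap (T : Module.End ℂ V) : Module.End ℂ (Module.End ℂ V) :=
  LinearMap.mulLeft ℂ T - LinearMap.mulRight ℂ T

theorem commutatorMap_apply (T S : Module.End ℂ V) : commutatorMap T S = T * S - S * T := rfl

/-- Binomial theorem: left multiplication by `T` is the sum of the commuting maps `commutatorMap T`
and right multiplication by `T`. -/
theorem pow_mul_eq_sum_commutatorMap (T S : Module.End ℂ V) (n : ℕ) :
    T ^ n * S = ∑ p ∈ antidiagonal n, n.choose p.1 •
      (((commutatorMap T) ^ p.1) S * T ^ p.2) := by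
  have hc : Commute (commutatorMap T) (LinearMap.mulRight ℂ T) :=
    (LinearMap.commute_mulLeft_right (R := ℂ) T T).sub_left (Commute.refl _)
  have h := hc.add_pow' n
  have e : commutatorMap T + LinearMap.mulRight ℂ T
      = LinearMap.mulLeft ℂ T :=
    sub_add_cancel _ _
  rw [e, LinearMap.pow_mulLeft] at h
  have h' := LinearMap.congr_fun h S
  rw [LinearMap.mulLeft_apply] at h'
  rw [h', LinearMap.sum_apply]
  refine sum_congr rfl fun p _ => ?_
  rw [(hc.pow_pow _ _).eq, LinearMap.smul_apply, Module.End.mul_apply, LinearMap.pow_mulRight,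
    LinearMap.mulRight_apply]

/-- Conjugation by `exp T` is the exponential of `commutatorMap T`. -/
theorem locExp_apply_eq {T : Module.End ℂ V} (hT : ∀ v, ∃ n, (T ^ n) v = 0) (S : Module.End ℂ V)
    {N : ℕ} (hN : ((commutatorMap T) ^ N) S = 0) (v : V) :
    locExp hT (S v) = truncExp (commutatorMap T) N S (locExp hT v) := by
  obtain ⟨K, hK⟩ := hT v
  obtain ⟨L, hL⟩ := hT (S v)
  -- `N + K` bounds `i + j` for all `i < N`, `j < K`, so the double sum can be grouped by total
  -- degree.
  set M := max L (N + K)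
  have hM : (T ^ M) (S v) = 0 := pow_apply_eq_zero_of_le hL (le_max_left _ _)
  rw [locExp_eq hT hM, locExp_eq hT hK, truncExp_apply, truncExp_apply, truncExp_apply,
    LinearMap.sum_apply]
  simp only [map_sum, LinearMap.smul_apply, map_smul]
  rw [← sum_product', ← sum_fiberwise_of_maps_to (t := range M) (g := fun p : ℕ × ℕ => p.1 + p.2)]
  swap
  · rintro ⟨i, j⟩ hp
    simp only [mem_product, mem_range] at hp ⊢
    exact lt_of_lt_of_le (by omega) (le_max_right _ _)
  refine sum_congr rfl fun n _ => ?_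
  rw [← Module.End.mul_apply, pow_mul_eq_sum_commutatorMap, LinearMap.sum_apply, smul_sum]
  symm
  refine (sum_subset (s₂ := antidiagonal n) ?_ ?_).trans (sum_congr rfl ?_)
  · rintro ⟨i, j⟩ hp
    simp only [mem_filter] at hp
    simpa using hp.2
  · rintro ⟨i, j⟩ hp hn
    simp only [HasAntidiagonal.mem_antidiagonal] at hp
    simp only [mem_filter, mem_product, mem_range, hp, and_true, not_and_or, not_lt] at hn
    rcases hn with hn | hn
    · simp [pow_apply_eq_zero_of_le hN hn]
    · simp [pow_apply_eq_zero_of_le hK hn]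
  · rintro ⟨i, j⟩ hp
    rw [HasAntidiagonal.mem_antidiagonal] at hp
    subst hp
    simp only [LinearMap.smul_apply, Module.End.mul_apply]
    rw [← Nat.cast_smul_eq_nsmul ℂ, smul_smul, smul_smul, Nat.cast_add_choose]
    congr 1
    have := Nat.factorial_ne_zero (i + j)
    field_simp

/-- `exp T` intertwines `S` with its conjugate; as it is onto, local nilpotency transfers without
constructing an inverse. -/
theorem truncExp_commutatorMap_locallyNilpotent {T S : Module.End ℂ V} (hT : ∀ v, ∃ n, (T ^ n) v = 0)
    (hS : ∀ v, ∃ n, (S ^ n) v = 0) {N : ℕ}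
    (hN : ((commutatorMap T) ^ N) S = 0) (v : V) :
    ∃ n, (truncExp (commutatorMap T) N S ^ n) v = 0 := by
  obtain ⟨w, rfl⟩ := locExp_surjective hT v
  have H : ∀ n, (truncExp (commutatorMap T) N S ^ n) (locExp hT w)
      = locExp hT ((S ^ n) w) := by
    intro n
    induction n with
    | zero => simp
    | succ n ih =>
      rw [pow_succ', pow_succ', Module.End.mul_apply, Module.End.mul_apply, ih,
        locExp_apply_eq hT S hN]
  obtain ⟨n, hn⟩ := hS w
  exact ⟨n, by rw [H, hn, locExp_zero]⟩

theorem exists_commutatorMap_pow_apply_eq_zero {T : Module.End ℂ V} (hT : ∀ v, ∃ n, (T ^ n) v = 0)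
    (S : Module.End ℂ V) (v : V) :
    ∃ m, ∀ n, m ≤ n → ((commutatorMap T) ^ n) S v = 0 := by
  obtain ⟨k, hk⟩ := hT v
  induction k generalizing v with
  | zero => exact ⟨0, fun n _ => by rw [show v = 0 by simpa using hk, map_zero]⟩
  | succ k ih =>
    obtain ⟨m, hm⟩ := ih (T v) (by rwa [← Module.End.mul_apply, ← pow_succ])
    -- From order `m` on, the iterated commutators kill `T v`, so each further commutator just
    -- applies `T` to the value at `v`.
    have step : ∀ j, ((commutatorMap T) ^ (m + j)) S v
        = (T ^ j) (((commutatorMap T) ^ m) S v) := by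
      intro j
      induction j with
      | zero => simp
      | succ j ihj =>
        rw [← add_assoc, pow_succ', Module.End.mul_apply, commutatorMap_apply,
          LinearMap.sub_apply, Module.End.mul_apply, Module.End.mul_apply, ihj,
          hm _ (Nat.le_add_right m j), sub_zero, pow_succ', Module.End.mul_apply]
    obtain ⟨l, hl⟩ := hT (((commutatorMap T) ^ m) S v)
    refine ⟨m + l, fun n hn => ?_⟩
    obtain ⟨j, rfl⟩ := Nat.exists_eq_add_of_le (le_trans (Nat.le_add_right m l) hn)
    rw [step, pow_apply_eq_zero_of_le hl (by omega)]

/-- If a polynomial with coefficients in a vector space takes all its values in a subspace, then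
its coefficients lie in that subspace. -/
theorem coeff_mem_of_forall_sum_mem (W : Submodule ℂ V) {N : ℕ} (c : ℕ → V)
    (h : ∀ t : ℂ, ∑ i ∈ range N, t ^ i • c i ∈ W) {i : ℕ} (hi : i < N) : c i ∈ W := by
  by_contra hc
  -- A functional separating `c i` from `W` reduces the claim to scalar polynomials.
  obtain ⟨φ, hφ, hW⟩ := W.exists_le_ker_of_notMem hc
  let p : Polynomial ℂ := ∑ j ∈ range N, Polynomial.monomial j (φ (c j))
  have hp : p = 0 := Polynomial.funext fun t => by
    have := hW (h t)
    simp only [LinearMap.mem_ker, map_sum, map_smul, smul_eq_mul] at this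
    simp only [p, Polynomial.eval_finsetSum, Polynomial.eval_monomial, Polynomial.eval_zero]
    rw [← this]
    exact sum_congr rfl fun j _ => mul_comm _ _
  have hcoeff : p.coeff i = φ (c i) := by
    simp [p, Polynomial.finsetSum_coeff, Polynomial.coeff_monomial, hi]
  exact hφ (by rw [← hcoeff, hp, Polynomial.coeff_zero])

end LocallyNilpotent

/-! ### Brackets of locally nilpotent derivations -/

variable {A : Type*} [CommRing A] [Algebra ℂ A]

theorem isLND_iff {D : Derivation ℂ A A} :
    IsLND D ↔ ∀ f : A, ∃ n, ((D : Module.End ℂ A) ^ n) f = 0 := by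
  simp only [IsLND, Module.End.pow_apply]
  rfl

theorem IsLND.smul {D : Derivation ℂ A A} (h : IsLND D) (t : ℂ) : IsLND (t • D) := by
  rw [isLND_iff] at h ⊢
  intro f
  obtain ⟨n, hn⟩ := h f
  refine ⟨n, ?_⟩
  rw [Derivation.coe_smul_linearMap, smul_pow, LinearMap.smul_apply, hn, smul_zero]

theorem coe_ad_pow (Θ D : Derivation ℂ A A) (n : ℕ) :
    ((((LieAlgebra.ad ℂ (Derivation ℂ A A) Θ) ^ n) D : Derivation ℂ A A) : Module.End ℂ A)
      = ((commutatorMap (Θ : Module.End ℂ A)) ^ n) (D : Module.End ℂ A) := by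
  induction n with
  | zero => simp
  | succ n ih =>
    rw [pow_succ', pow_succ', Module.End.mul_apply, Module.End.mul_apply, ← ih,
      LieAlgebra.ad_apply, commutatorMap_apply]
    rfl

theorem coe_truncExp_ad (Θ D : Derivation ℂ A A) (N : ℕ) :
    ((truncExp (LieAlgebra.ad ℂ (Derivation ℂ A A) Θ) N D : Derivation ℂ A A) : Module.End ℂ A)
      = truncExp (commutatorMap (Θ : Module.End ℂ A)) N
        (D : Module.End ℂ A) := by
  ext a
  rw [truncExp_apply, truncExp_apply, LinearMap.sum_apply]
  simp only [← coe_ad_pow, LinearMap.smul_apply, Derivation.coeFn_coe]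
  rw [← Derivation.coeFnAddMonoidHom_apply, map_sum, Finset.sum_apply]
  rfl

/-- On the derivations of a finitely generated algebra, the adjoint action of a locally nilpotent
derivation is locally nilpotent. -/
theorem IsLND.exists_ad_pow_eq_zero [Algebra.FiniteType ℂ A] {Θ : Derivation ℂ A A}
    (hΘ : IsLND Θ) (D : Derivation ℂ A A) :
    ∃ n, ((LieAlgebra.ad ℂ (Derivation ℂ A A) Θ) ^ n) D = 0 := by
  obtain ⟨s, hs⟩ := Algebra.FiniteType.out (R := ℂ) (A := A)
  choose m hm using exists_commutatorMap_pow_apply_eq_zero (isLND_iff.1 hΘ) (D : Module.End ℂ A)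
  refine ⟨s.sup m, Derivation.ext_of_adjoin_eq_top _ hs fun a ha => ?_⟩
  have := hm a (s.sup m) (Finset.le_sup ha)
  rw [← coe_ad_pow] at this
  exact this

theorem IsLND.truncExp_ad {Θ Ψ : Derivation ℂ A A} (hΘ : IsLND Θ) (hΨ : IsLND Ψ) {N : ℕ}
    (hN : ((LieAlgebra.ad ℂ (Derivation ℂ A A) Θ) ^ N) Ψ = 0) :
    IsLND (truncExp (LieAlgebra.ad ℂ (Derivation ℂ A A) Θ) N Ψ) := by
  rw [isLND_iff] at *
  rw [coe_truncExp_ad]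
  exact truncExp_commutatorMap_locallyNilpotent hΘ hΨ (by rw [← coe_ad_pow, hN]; rfl)

/-- The bracket of two locally nilpotent derivations of a finitely generated algebra is a linear
combination of locally nilpotent derivations. -/
theorem IsLND.lie_mem_span [Algebra.FiniteType ℂ A] {Θ Ψ : Derivation ℂ A A} (hΘ : IsLND Θ)
    (hΨ : IsLND Ψ) : ⁅Θ, Ψ⁆ ∈ Submodule.span ℂ {D : Derivation ℂ A A | IsLND D} := by
  obtain ⟨n, hn⟩ := hΘ.exists_ad_pow_eq_zero Ψ
  -- The `+ 2` keeps the linear coefficient in range even when `n = 0`.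
  have hN := pow_apply_eq_zero_of_le hn (Nat.le_add_right n 2)
  have := coeff_mem_of_forall_sum_mem (Submodule.span ℂ {D : Derivation ℂ A A | IsLND D})
    (N := n + 2) (fun i => ((i.factorial : ℂ)⁻¹) •
      ((LieAlgebra.ad ℂ (Derivation ℂ A A) Θ) ^ i) Ψ) (fun t => ?_) (i := 1) (by omega)
  · simpa using this
  · have ht : ∀ i, ((LieAlgebra.ad ℂ (Derivation ℂ A A) (t • Θ)) ^ i) Ψ
        = t ^ i • ((LieAlgebra.ad ℂ (Derivation ℂ A A) Θ) ^ i) Ψ := fun i => by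
      rw [map_smul, smul_pow, LinearMap.smul_apply]
    have key := (hΘ.smul t).truncExp_ad hΨ (N := n + 2) (by rw [ht, hN, smul_zero])
    rw [truncExp_apply] at key
    simp only [ht] at key
    simp only [smul_comm (t ^ _)]
    exact Submodule.subset_span key

theorem lie_smul_derivation (D E : Derivation ℂ A A) (g : A) :
    ⁅D, g • E⁆ = D g • E + g • ⁅D, E⁆ := by
  ext a
  simp only [Derivation.commutator_apply, Derivation.smul_apply, Derivation.add_apply,
    Derivation.leibniz, smul_eq_mul]
  ring

/-- On a complex algebra of finite type, the module spanned by the locally nilpotent derivations is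
a Lie subalgebra. -/
theorem lie_mem_span_isLND [Algebra.FiniteType ℂ A] {D E : Derivation ℂ A A}
    (hD : D ∈ Submodule.span A {D : Derivation ℂ A A | IsLND D})
    (hE : E ∈ Submodule.span A {D : Derivation ℂ A A | IsLND D}) :
    ⁅D, E⁆ ∈ Submodule.span A {D : Derivation ℂ A A | IsLND D} := by
  induction hE using Submodule.span_induction with
  | zero => simp
  | add E F _ _ hE hF => rw [lie_add]; exact add_mem hE hF
  | smul g E hE ih =>
    rw [lie_smul_derivation]
    exact add_mem (Submodule.smul_mem _ _ hE) (Submodule.smul_mem _ _ ih)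
  | mem E hE =>
    -- Swapping puts `D` in the second slot, where the same Leibniz rule expands it.
    rw [← lie_skew, neg_mem_iff]
    induction hD using Submodule.span_induction with
    | zero => simp
    | add D F _ _ hD hF => rw [lie_add]; exact add_mem hD hF
    | smul g D hD ih =>
      rw [lie_smul_derivation]
      exact add_mem (Submodule.smul_mem _ _ hD) (Submodule.smul_mem _ _ ih)
    | mem D hD => exact Submodule.span_le_restrictScalars ℂ A _ (IsLND.lie_mem_span hE hD)

/-- If the overshear density property holds, the locally nilpotent derivations span the module of
all derivations. -/
theorem AlgebraicOvershearDensityProperty.span_isLND_eq_top [Algebra.FiniteType ℂ A]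
    (h : AlgebraicOvershearDensityProperty A) :
    Submodule.span A {D : Derivation ℂ A A | IsLND D} = ⊤ := by
  let L : LieSubalgebra ℂ (Derivation ℂ A A) :=
    { (Submodule.span A {D : Derivation ℂ A A | IsLND D}).restrictScalars ℂ with
      lie_mem' := fun hD hE => lie_mem_span_isLND hD hE }
  have hL : LieSubalgebra.lieSpan ℂ (Derivation ℂ A A) {D | IsAlgebraicOvershear D} ≤ L := by
    rw [LieSubalgebra.lieSpan_le]
    rintro _ ⟨Θ, f, hΘ, -, rfl⟩
    exact Submodule.smul_mem _ f (Submodule.subset_span hΘ)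
  rw [h] at hL
  exact eq_top_iff.2 fun D _ => hL (LieSubalgebra.mem_top D)

/-! ### Values at points -/

theorem vectorAt_apply (x : MaximalSpectrum A) (D : Derivation ℂ A A) (a : A) :
    vectorAt x D a = Ideal.Quotient.mk x.asIdeal (D a) := rfl

/-- On a smooth variety every tangent vector is the value of an algebraic vector field. -/
theorem vectorAt_surjective [Algebra.Smooth ℂ A] (x : MaximalSpectrum A) :
    Function.Surjective (vectorAt x) := by
  intro v
  -- Smoothness makes the Kähler differentials projective, so the functional given by `v` lifts to
  -- `A`.
  obtain ⟨φ, hφ⟩ := Module.projective_lifting_property (Submodule.mkQ x.asIdeal)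
    v.liftKaehlerDifferential (Submodule.mkQ_surjective _)
  refine ⟨φ.compDer (KaehlerDifferential.D ℂ A), ?_⟩
  ext a
  have := LinearMap.congr_fun hφ (KaehlerDifferential.D ℂ A a)
  rwa [Derivation.liftKaehlerDifferential_comp_D] at this

/-- The Nullstellensatz: at a closed point a regular function takes a complex value. -/
theorem exists_value [Algebra.FiniteType ℂ A] (x : MaximalSpectrum A) (f : A) :
    ∃ c : ℂ, Ideal.Quotient.mk x.asIdeal f = algebraMap ℂ (A ⧸ x.asIdeal) c := by
  have := x.isMaximal
  let _ : Field (A ⧸ x.asIdeal) := Ideal.Quotient.field _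
  have : Module.Finite ℂ (A ⧸ x.asIdeal) := finite_of_finite_type_of_isJacobsonRing _ _
  obtain ⟨c, hc⟩ := IsAlgClosed.algebraMap_bijective_of_isIntegral (k := ℂ)
    (K := A ⧸ x.asIdeal) |>.2 (Ideal.Quotient.mk x.asIdeal f)
  exact ⟨c, hc.symm⟩

end ComplexAffine

theorem mainTheorem2 (A : Type*) [CommRing A] [Algebra ℂ A] [Algebra.Smooth ℂ A]
    (h : ComplexAffine.AlgebraicOvershearDensityProperty A) :
    ComplexAffine.IsFlexible A := by
  intro x
  refine eq_top_iff.2 fun v _ => ?_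
  obtain ⟨D, rfl⟩ := ComplexAffine.vectorAt_surjective x v
  have hD : D ∈ Submodule.span A {D : Derivation ℂ A A | ComplexAffine.IsLND D} := by
    rw [h.span_isLND_eq_top]
    trivial
  induction hD using Submodule.span_induction with
  | zero =>
    convert Submodule.zero_mem _
    ext a
    simp [ComplexAffine.vectorAt_apply]
  | mem D hD => exact Submodule.subset_span ⟨D, hD, rfl⟩
  | add D E _ _ hD hE =>
    convert Submodule.add_mem _ (hD trivial) (hE trivial)
    ext a
    simp [ComplexAffine.vectorAt_apply]
  | smul f D _ ih =>
    -- The value of `f • D` at `x` is `f(x)` times that of `D`, with `f(x) = c` complex.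
    obtain ⟨c, hc⟩ := ComplexAffine.exists_value x f
    convert Submodule.smul_mem _ c (ih trivial)
    ext a
    simp [ComplexAffine.vectorAt_apply, hc, Algebra.smul_def]
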